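/- Let $A$ be an $r\times n$ totally unimodular integer matrix (every square submatrix has determinant $0$, $1$ or $-1$) with columns $v_1,\dots,v_n\in\mathbb{R}^r$, and let $q_1,\dots,q_n$ be positive integers. Let $E_A(q_1,\dots,q_n)$ be the number of points of $\mathbb{Z}^r$ in the zonotope $$\Big\{\sum_{i=1}^n c_i q_i v_i : 0\le c_i\le 1 \text{ for } i=1,\dots,n\Big\}.$$ Then this number is finite and $$E_A(q_1,\dots,q_n)=\sum_F\prod_{e\in F}q_e,$$ where $F$ ranges over all subsets of $\{1,2,\dots,n\}$ such that the indexed family $(v_e)_{e\in F}$ is linearly independent over $\mathbb{R}$ (so equal columns with different indices are dependent). -/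

import Mathlib

open scoped BigOperators

/-- The `e`-th column of the integer matrix `A`, regarded as a vector in `ℝ^r`. -/
def realColumn {r n : ℕ} (A : Matrix (Fin r) (Fin n) ℤ) (e : Fin n) : Fin r → ℝ :=
  fun i => (A i e : ℝ)

/-- The `(q₁, …, qₙ)`-dilate `{∑ cᵢ qᵢ vᵢ : 0 ≤ cᵢ ≤ 1}` of the zonotope of `A`, where
`v₁, …, vₙ` are the columns of `A`. -/
def dilatedZonotope {r n : ℕ} (A : Matrix (Fin r) (Fin n) ℤ) (q : Fin n → ℕ) :
    Set (Fin r → ℝ) :=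
  {x | ∃ c : Fin n → ℝ, (∀ e, 0 ≤ c e ∧ c e ≤ 1) ∧
    x = ∑ e, (c e * (q e : ℝ)) • realColumn A e}

/-- The lattice points `ℤ^r` of `ℝ^r`. -/
def latticePoints (r : ℕ) : Set (Fin r → ℝ) :=
  {x | ∃ z : Fin r → ℤ, ∀ i, x i = (z i : ℝ)}

/-- The number `E_A(q₁, …, qₙ)` of lattice points of the `(q₁, …, qₙ)`-dilate of the zonotope
of `A`. -/
noncomputable def generalizedEhrhart {r n : ℕ} (A : Matrix (Fin r) (Fin n) ℤ)
    (q : Fin n → ℕ) : ℕ :=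
  (dilatedZonotope A q ∩ latticePoints r).ncard

open Classical in
/-- The subsets `F` of the index set for which the family of columns `(v_e)_{e ∈ F}` is linearly
independent over `ℝ` (equal columns with different indices are counted as different members of
the family, so they make it dependent). -/
noncomputable def independentColumnSets {r n : ℕ} (A : Matrix (Fin r) (Fin n) ℤ) :
    Finset (Finset (Fin n)) :=
  Finset.univ.filter fun F => LinearIndependent ℝ (fun e : F => realColumn A e)

/-! Total unimodularity is used only for integrality: an integral system solvable over the reals in
an integral box is solvable there over the integers. Hence the lattice points of the zonotope are
the sums of columns with integer coefficients between 0 and `q e`, and the columns satisfy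
`IsBoxIntegral`.

That property makes sense in any abelian group and survives deleting a vector and passing to the
quotient by its span, so deletion-contraction applies. Convexity makes each line in a nonzero
direction `v a` gain exactly one point whenever `q a` grows by one, so the count is that of the
deletion plus `q a` times that of the contraction (`ncard_boxSums_insert`). The sum over independent
sets obeys the same recursion, split by whether `a ∈ F`. -/

/-! ### Integrality of totally unimodular systems -/

/-- Some maximal square submatrix of a real matrix with independent columns is nonsingular. -/
theorem Matrix.exists_isUnit_submatrix_of_linearIndependent_col {m J : Type*} [Fintype m]
    [Fintype J] [DecidableEq J] (B : Matrix m J ℝ) (hB : LinearIndependent ℝ B.col) :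
    ∃ f : J → m, IsUnit (B.submatrix f id) := by
  obtain ⟨κ, a, ha, hspan, hli⟩ := exists_linearIndependent' ℝ B.row
  have : Finite κ := Finite.of_injective a ha
  have := Fintype.ofFinite κ
  have hcard : Fintype.card κ = Fintype.card J := by
    have h1 := finrank_span_eq_card hli
    rw [hspan, ← Matrix.rank_eq_finrank_span_row] at h1
    have h2 : (Matrix.transpose B).rank = Fintype.card J := LinearIndependent.rank_matrix hB
    rw [Matrix.rank_transpose] at h2
    omega
  let e : J ≃ κ := (Fintype.equivOfCardEq hcard).symm
  refine ⟨a ∘ e, Matrix.linearIndependent_rows_iff_isUnit.1 ?_⟩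
  exact hli.comp e e.injective

/-- An integral system with totally unimodular matrix and independent columns has only integral
real solutions. -/
theorem Matrix.IsTotallyUnimodular.exists_int_of_linearIndependent_col {m J : Type*} [Fintype m]
    [Fintype J] {A : Matrix m J ℤ} (hA : A.IsTotallyUnimodular)
    (hli : LinearIndependent ℝ (A.map (Int.cast : ℤ → ℝ)).col) (c : J → ℝ) (y : m → ℤ)
    (hc : ∀ i, ∑ e, c e * (A i e : ℝ) = y i) : ∃ d : J → ℤ, ∀ e, c e = d e := by
  classical
  obtain ⟨f, hf⟩ := Matrix.exists_isUnit_submatrix_of_linearIndependent_col _ hli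
  set C : Matrix J J ℤ := A.submatrix f id with hCdef
  have hCmap : (A.map (Int.cast : ℤ → ℝ)).submatrix f id = C.map (Int.cast : ℤ → ℝ) := rfl
  rw [hCmap] at hf
  have hdet : C.det ≠ 0 := by
    intro h0
    have h1 := (Matrix.isUnit_iff_isUnit_det _).1 hf
    have h2 : (C.map (Int.cast : ℤ → ℝ)).det = ((C.det : ℤ) : ℝ) :=
      ((Int.castRingHom ℝ).map_det C).symm
    rw [h2, h0] at h1
    simp at h1
  have hunit : IsUnit C.det := by
    obtain ⟨s, hs⟩ := (Matrix.isTotallyUnimodular_iff_fintype A).1 hA J f id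
    rw [← hCdef] at hs
    rw [Int.isUnit_iff]
    cases s
    · exact absurd hs.symm hdet
    · exact Or.inr hs.symm
    · exact Or.inl hs.symm
  refine ⟨C⁻¹.mulVec (y ∘ f), fun e => ?_⟩
  have h1 : C.mulVec (C⁻¹.mulVec (y ∘ f)) = y ∘ f := by
    rw [Matrix.mulVec_mulVec, Matrix.mul_nonsing_inv _ hunit, Matrix.one_mulVec]
  have h2 : (C.map (Int.cast : ℤ → ℝ)).mulVec c
      = (C.map (Int.cast : ℤ → ℝ)).mulVec (fun e => ((C⁻¹.mulVec (y ∘ f)) e : ℝ)) := by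
    ext j
    have hl := hc (f j)
    have hr := congrFun h1 j
    simp only [Matrix.mulVec, dotProduct, Function.comp] at hr
    have hr' : ((∑ x, C j x * ∑ x_1, C⁻¹ x x_1 * y (f x_1) : ℤ) : ℝ) = (y (f j) : ℤ) := by
      exact_mod_cast hr
    simp only [Matrix.mulVec, dotProduct, Matrix.map_apply]
    calc ∑ x, (C j x : ℝ) * c x = y (f j) := by
          rw [← hl]; exact Finset.sum_congr rfl fun x _ => mul_comm _ _
      _ = _ := by rw [← hr']; push_cast; rfl
  exact congrFun (Matrix.mulVec_injective_of_isUnit hf h2) e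

/-- A point of a box that is interior in every coordinate of the support of `w` can be moved along
`w` until it reaches a face of the box. -/
theorem exists_move_to_box_face {ι : Type*} [Fintype ι] (c q w : ι → ℝ)
    (hbox : ∀ e, 0 ≤ c e ∧ c e ≤ q e) (hw : ∃ e, w e ≠ 0)
    (hint : ∀ e, w e ≠ 0 → 0 < c e ∧ c e < q e) :
    ∃ t : ℝ, (∀ e, 0 ≤ c e + t * w e ∧ c e + t * w e ≤ q e) ∧
      ∃ e, w e ≠ 0 ∧ (c e + t * w e = 0 ∨ c e + t * w e = q e) := by
  classical
  -- The time at which coordinate `e` leaves its interval; the smallest one is used.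
  let τ : ι → ℝ := fun e => if 0 < w e then (q e - c e) / w e else (0 - c e) / w e
  obtain ⟨a, ha, hmin⟩ := (Finset.univ.filter fun e => w e ≠ 0).exists_min_image τ
    (by obtain ⟨e, he⟩ := hw; exact ⟨e, by simpa using he⟩)
  have hτ : ∀ e, w e ≠ 0 → 0 < τ e := by
    intro e he
    obtain ⟨h1, h2⟩ := hint e he
    by_cases h : 0 < w e
    · simp only [τ, if_pos h]; exact div_pos (by linarith) h
    · simp only [τ, if_neg h]
      exact div_pos_of_neg_of_neg (by linarith) (lt_of_le_of_ne (not_lt.1 h) he)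
  have hwa : w a ≠ 0 := by simpa using ha
  refine ⟨τ a, fun e => ?_, a, hwa, ?_⟩
  · by_cases he : w e = 0
    · simpa [he] using hbox e
    have hle : τ a ≤ τ e := hmin e (by simpa using he)
    have hpos := hτ a hwa
    obtain ⟨h1, h2⟩ := hint e he
    by_cases h : 0 < w e
    · simp only [τ, if_pos h] at hle
      rw [le_div_iff₀ h] at hle
      exact ⟨by nlinarith, by simp only [τ]; linarith⟩
    · have h' : w e < 0 := lt_of_le_of_ne (not_lt.1 h) he
      have hle' : τ a ≤ (0 - c e) / w e := by simpa only [τ, if_neg h] using hle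
      rw [le_div_iff_of_neg h'] at hle'
      exact ⟨by linarith, by nlinarith⟩
  · by_cases h : 0 < w a
    · right; simp only [τ, if_pos h]; field_simp; ring
    · left; simp only [τ, if_neg h]; field_simp; ring

/-- An integral system with totally unimodular matrix which is solvable in a box with integral
vertices has an integral solution in that box. -/
theorem Matrix.IsTotallyUnimodular.exists_nat_solution {m ι : Type*} [Fintype m]
    [Fintype ι] {A : Matrix m ι ℤ} (hA : A.IsTotallyUnimodular) (q : ι → ℕ) (y : m → ℤ)
    (c : ι → ℝ) (hbox : ∀ e, 0 ≤ c e ∧ c e ≤ q e)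
    (hc : ∀ i, ∑ e, c e * (A i e : ℝ) = y i) :
    ∃ d : ι → ℕ, (∀ e, d e ≤ q e) ∧ ∀ i, ∑ e, (d e : ℤ) * A i e = y i := by
  classical
  induction hk : (Finset.univ.filter fun e => ¬ ∃ z : ℤ, c e = z).card using Nat.strong_induction_on
    generalizing c with
  | _ k ih =>
  let P : ι → Prop := fun e => ¬ ∃ z : ℤ, c e = z
  by_cases hli : LinearIndependent ℝ ((A.submatrix id (Subtype.val : {e // P e} → ι)).map
      (Int.cast : ℤ → ℝ)).col
  -- Moving the integral coordinates to the right-hand side leaves an integral system in independent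
  -- columns, so no fractional coordinate exists.
  · have hint : ∀ e, ∃ z : ℤ, c e = z := by
      choose g hg using fun e : {e // ¬ P e} => not_not.1 e.2
      obtain ⟨d, hd⟩ := (hA.submatrix id (Subtype.val : {e // P e} → ι)
        ).exists_int_of_linearIndependent_col hli (fun e => c e)
        (fun i => y i - ∑ e : {e // ¬ P e}, g e * A i e) (fun i => by
          have h := hc i
          rw [← Fintype.sum_subtype_add_sum_subtype P] at h
          push_cast
          simp only [Matrix.submatrix_apply, id]
          rw [← h, eq_sub_iff_add_eq]
          congr 1
          exact Finset.sum_congr rfl fun e _ => by rw [hg e])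
      intro e
      by_contra he
      exact he ⟨d ⟨e, he⟩, hd ⟨e, he⟩⟩
    choose z hz using hint
    have hz0 : ∀ e, 0 ≤ z e := fun e => by
      have := (hbox e).1; rw [hz e] at this; exact_mod_cast this
    refine ⟨fun e => (z e).toNat, fun e => ?_, fun i => ?_⟩
    · have := (hbox e).2
      rw [hz e] at this
      have h : z e ≤ (q e : ℤ) := by exact_mod_cast this
      exact Int.toNat_le.2 h
    · have := hc i
      simp only [Int.toNat_of_nonneg (hz0 _)]
      simp only [hz] at this
      exact_mod_cast this
  · obtain ⟨g, hg, e₀, he₀⟩ := Fintype.not_linearIndependent_iff.1 hli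
    let w : ι → ℝ := fun e => if h : P e then g ⟨e, h⟩ else 0
    have hwP : ∀ e, w e ≠ 0 → P e := fun e he => by
      by_contra h; exact he (dif_neg (not_not.2 h))
    have hker : ∀ i, ∑ e, w e * (A i e : ℝ) = 0 := fun i => by
      rw [← Fintype.sum_subtype_add_sum_subtype P]
      have h1 : ∑ e : {e // ¬ P e}, w e * (A i e : ℝ) = 0 :=
        Finset.sum_eq_zero fun e _ => by simp only [w, dif_neg e.2, zero_mul]
      rw [h1, add_zero]
      have h2 := congrFun hg i
      simp only [Finset.sum_apply, Pi.smul_apply, smul_eq_mul, Pi.zero_apply] at h2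
      rw [← h2]
      exact Finset.sum_congr rfl fun e _ => by simp only [w, dif_pos e.2]; rfl
    obtain ⟨t, ht, a, hwa, hface⟩ := exists_move_to_box_face c (fun e => (q e : ℝ)) w hbox
      ⟨e₀, by simpa only [w, dif_pos e₀.2] using he₀⟩ (fun e he => by
        have hP := hwP e he
        refine ⟨lt_of_le_of_ne (hbox e).1 fun h => hP ⟨0, by simp [← h]⟩,
          lt_of_le_of_ne (hbox e).2 fun h => hP ⟨q e, by simp [h]⟩⟩)
    -- The move fixes every integral coordinate and makes the fractional coordinate `a` integral.
    refine ih _ ?_ (fun e => c e + t * w e) ht (fun i => ?_) rfl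
    · rw [← hk]
      refine Finset.card_lt_card ⟨fun e he => ?_, fun hsub => ?_⟩
      · simp only [Finset.mem_filter, Finset.mem_univ, true_and] at he ⊢
        intro hz
        have : w e = 0 := by by_contra h; exact hwP e h hz
        exact he (by simpa [this] using hz)
      · have hmem : a ∈ Finset.univ.filter fun e => ¬ ∃ z : ℤ, c e = z := by
          exact Finset.mem_filter.2 ⟨Finset.mem_univ _, hwP a hwa⟩
        have := hsub hmem
        simp only [Finset.mem_filter, Finset.mem_univ, true_and] at this
        rcases hface with h | h
        · exact this ⟨0, by simp [h]⟩
        · exact this ⟨q a, by simp [h]⟩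
    · simp only [add_mul, Finset.sum_add_distrib, hc i, mul_assoc, ← Finset.mul_sum, hker i]
      simp

/-! ### Box sums in abelian groups: deletion and contraction -/

/-- The set of all sums `∑ i ∈ s, d i • v i` with natural coefficients `d i ≤ q i`. -/
def boxSums {ι M : Type*} [AddCommGroup M] (v : ι → M) (s : Finset ι) (q : ι → ℕ) : Set M :=
  {x | ∃ d : ι → ℕ, (∀ i ∈ s, d i ≤ q i) ∧ x = ∑ i ∈ s, d i • v i}

/-- Every element of the group with a multiple `k • x` in the `k`-fold dilate of a box sum lies in
the box sum itself. -/
def IsBoxIntegral {ι M : Type*} [AddCommGroup M] (v : ι → M) (s : Finset ι) : Prop :=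
  ∀ (q : ι → ℕ) (x : M) (k : ℕ), 0 < k → k • x ∈ boxSums v s (k • q) → x ∈ boxSums v s q

section
variable {ι M : Type*} [AddCommGroup M] {v : ι → M} {s : Finset ι}

theorem boxSums_finite (v : ι → M) (s : Finset ι) (q : ι → ℕ) : (boxSums v s q).Finite := by
  classical
  refine (Set.Finite.image (fun d : (i : ι) → i ∈ s → ℕ => ∑ i ∈ s.attach, d i.1 i.2 • v i)
    (s.pi fun i => Finset.range (q i + 1)).finite_toSet).subset ?_
  rintro x ⟨d, hd, rfl⟩
  refine ⟨fun i _ => d i, ?_, ?_⟩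
  · simpa [Nat.lt_succ_iff] using hd
  · exact Finset.sum_attach s fun i => d i • v i

theorem boxSums_congr {q q' : ι → ℕ} (h : ∀ i ∈ s, q i = q' i) :
    boxSums v s q = boxSums v s q' := by
  ext x
  refine exists_congr fun d => and_congr_left fun _ => forall₂_congr fun i hi => by rw [h i hi]

theorem mem_boxSums_insert [DecidableEq ι] {a : ι} (ha : a ∉ s) {q : ι → ℕ} {x : M} :
    x ∈ boxSums v (insert a s) q ↔ ∃ j ≤ q a, ∃ b ∈ boxSums v s q, x = b + j • v a := by
  constructor
  · rintro ⟨d, hd, rfl⟩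
    refine ⟨d a, hd a (by simp), _, ⟨d, fun i hi => hd i (by simp [hi]), rfl⟩, ?_⟩
    rw [Finset.sum_insert ha, add_comm]
  · rintro ⟨j, hj, b, ⟨d, hd, rfl⟩, rfl⟩
    have hne : ∀ i ∈ s, i ≠ a := fun i hi h => ha (h ▸ hi)
    refine ⟨Function.update d a j, fun i hi => ?_, ?_⟩
    · rcases Finset.mem_insert.1 hi with rfl | hi
      · simpa using hj
      · simpa [hne i hi] using hd i hi
    · rw [Finset.sum_insert ha, add_comm]
      simp only [Function.update_self]
      congr 1
      exact Finset.sum_congr rfl fun i hi => by simp [hne i hi]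

theorem image_boxSums {N : Type*} [AddCommGroup N] (f : M →+ N) (q : ι → ℕ) :
    f '' boxSums v s q = boxSums (f ∘ v) s q := by
  ext x
  constructor
  · rintro ⟨_, ⟨d, hd, rfl⟩, rfl⟩
    exact ⟨d, hd, by simp⟩
  · rintro ⟨d, hd, rfl⟩
    exact ⟨_, ⟨d, hd, rfl⟩, by simp⟩

theorem IsBoxIntegral.of_insert [DecidableEq ι] {a : ι} (ha : a ∉ s)
    (h : IsBoxIntegral v (insert a s)) : IsBoxIntegral v s := by
  intro q x k hk hx
  have hne : ∀ i ∈ s, i ≠ a := fun i hi h => ha (h ▸ hi)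
  have := h (Function.update q a 0) x k hk ((mem_boxSums_insert ha).2 ⟨0, by simp, k • x, by
    rwa [boxSums_congr (q' := k • q) fun i hi => by simp [hne i hi]], by simp⟩)
  obtain ⟨j, hj, b, hb, rfl⟩ := (mem_boxSums_insert ha).1 this
  obtain rfl : j = 0 := by simpa using hj
  rw [boxSums_congr (q' := q) fun i hi => by simp [hne i hi]] at hb
  simpa using hb

/-- Box integrality passes to the contraction by one of the vectors. -/
theorem IsBoxIntegral.quotient [DecidableEq ι] {a : ι} (ha : a ∉ s)
    (h : IsBoxIntegral v (insert a s)) :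
    IsBoxIntegral ((Submodule.span ℤ {v a}).mkQ ∘ v) s := by
  have hne : ∀ i ∈ s, i ≠ a := fun i hi h => ha (h ▸ hi)
  have himg := fun q => image_boxSums (v := v) (s := s)
    (Submodule.span ℤ {v a}).mkQ.toAddMonoidHom q
  simp only [LinearMap.toAddMonoidHom_coe] at himg
  intro q x k hk hx
  obtain ⟨x, rfl⟩ := Submodule.mkQ_surjective _ x
  rw [← himg] at hx ⊢
  obtain ⟨b, hb, hbx⟩ := hx
  rw [← map_nsmul] at hbx
  obtain ⟨c, hc⟩ : ∃ c : ℤ, k • x = b + c • v a := by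
    have := (Submodule.Quotient.eq _).1 hbx.symm
    obtain ⟨c, hc⟩ := Submodule.mem_span_singleton.1 this
    exact ⟨c, by rw [hc]; abel⟩
  have hk' : (0 : ℤ) < k := by exact_mod_cast hk
  have hmod := Int.emod_nonneg c hk'.ne'
  have hlt := Int.emod_lt_of_pos c hk'
  -- Removing the quotient `c / k` leaves the remainder `c % k < k` as coefficient of `v a`, which
  -- fits the `k`-fold dilate of the bound 1.
  have key : x - (c / k) • v a ∈ boxSums v (insert a s) (Function.update q a 1) := by
    refine h _ _ k hk ((mem_boxSums_insert ha).2 ⟨(c % k).toNat, ?_, b, ?_, ?_⟩)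
    · simp only [Pi.smul_apply, Function.update_self, smul_eq_mul]; omega
    · rwa [boxSums_congr (q' := k • q) fun i hi => by simp [hne i hi]]
    · rw [smul_sub, hc, ← natCast_zsmul (v a), Int.toNat_of_nonneg hmod, Int.emod_def, sub_smul,
        mul_smul, natCast_zsmul]
      abel
  obtain ⟨j, -, b', hb', hx⟩ := (mem_boxSums_insert ha).1 key
  rw [boxSums_congr (q' := q) fun i hi => by simp [hne i hi]] at hb'
  refine ⟨b', hb', ((Submodule.Quotient.eq _).2 ?_).symm⟩
  refine Submodule.mem_span_singleton.2 ⟨j + c / k, ?_⟩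
  rw [sub_eq_iff_eq_add] at hx
  rw [hx, add_smul, natCast_zsmul]
  abel

/-- The box with `q = 0` contains only 0, so box integrality excludes torsion in the whole group. -/
theorem IsBoxIntegral.eq_zero_of_nsmul (h : IsBoxIntegral v s) {k : ℕ} (hk : 0 < k) {x : M}
    (hx : k • x = 0) : x = 0 := by
  obtain ⟨d, hd, rfl⟩ := h 0 x k hk ⟨0, by simp, by simpa using hx⟩
  exact Finset.sum_eq_zero fun i hi => by simp [Nat.le_zero.1 (hd i hi)]

/-- Box sums are convex in the directions of the group. -/
theorem IsBoxIntegral.add_mem_boxSums (h : IsBoxIntegral v s) {q : ι → ℕ} {x y : M} {k : ℕ}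
    (hx : x ∈ boxSums v s q) (hxy : x + (k + 1) • y ∈ boxSums v s q) :
    x + y ∈ boxSums v s q := by
  refine h q _ (k + 1) k.succ_pos ?_
  obtain ⟨d, hd, hdx⟩ := hx
  obtain ⟨d', hd', hdx'⟩ := hxy
  -- Uses `(k + 1) • (x + y) = k • x + (x + (k + 1) • y)`.
  refine ⟨fun i => k * d i + d' i, fun i hi => ?_, ?_⟩
  · simp only [Pi.smul_apply, smul_eq_mul]
    nlinarith [hd i hi, hd' i hi]
  · simp only [add_smul, mul_smul, Finset.sum_add_distrib, ← Finset.smul_sum, ← hdx, ← hdx']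
    simp only [smul_add, one_smul]
    abel

/-- Counting along the fibres of a projection: in direction `v a` the box sum grows by one point
over each point of its projection. -/
theorem IsBoxIntegral.ncard_boxSums_insert [DecidableEq ι] {a : ι} (ha : a ∉ s)
    (h : IsBoxIntegral v (insert a s)) (hv : v a ≠ 0) (q : ι → ℕ) :
    (boxSums v (insert a s) q).ncard = (boxSums v s q).ncard +
      q a * (boxSums ((Submodule.span ℤ {v a}).mkQ ∘ v) s q).ncard := by
  have hne : ∀ i ∈ s, i ≠ a := fun i hi h => ha (h ▸ hi)
  set π := (Submodule.span ℤ {v a}).mkQ with hπ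
  have hπa : π (v a) = 0 := by
    rw [hπ, Submodule.mkQ_apply, Submodule.Quotient.mk_eq_zero]
    exact Submodule.mem_span_singleton_self _
  have himg : π '' boxSums v s q = boxSums (π ∘ v) s q := image_boxSums π.toAddMonoidHom q
  let T : ℕ → Set M := fun m => boxSums v (insert a s) (Function.update q a m)
  have hT : ∀ m x, x ∈ T m ↔ ∃ j ≤ m, ∃ b ∈ boxSums v s q, x = b + j • v a := fun m x => by
    simp only [T]
    rw [mem_boxSums_insert ha,
      boxSums_congr (q' := q) fun i hi => Function.update_of_ne (hne i hi) _ _]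
    simp
  have hTfin : ∀ m, (T m).Finite := fun m => boxSums_finite _ _ _
  have hinj : Function.Injective fun j : ℕ => j • v a := by
    intro i j hij
    wlog hlt : i ≤ j generalizing i j
    · exact (this hij.symm (by omega)).symm
    obtain ⟨k, rfl⟩ := Nat.exists_eq_add_of_le hlt
    rcases Nat.eq_zero_or_pos k with rfl | hk
    · rfl
    · refine absurd (h.eq_zero_of_nsmul hk ?_) hv
      simpa [add_smul] using hij
  have hstep : ∀ m, (T (m + 1)).ncard = (T m).ncard + (boxSums (π ∘ v) s q).ncard := by
    intro m
    have hsub : T m ⊆ T (m + 1) := fun x hx => by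
      obtain ⟨j, hj, hb⟩ := (hT m x).1 hx
      exact (hT _ x).2 ⟨j, by omega, hb⟩
    have hshift : ∀ x, x ∈ T m → x + v a ∈ T (m + 1) := fun x hx => by
      obtain ⟨j, hj, b, hb, rfl⟩ := (hT m x).1 hx
      exact (hT _ _).2 ⟨j + 1, by omega, b, hb, by rw [succ_nsmul, add_assoc]⟩
    have hunshift : ∀ x, x ∈ T (m + 1) → x ∉ T m → x - v a ∈ T m := fun x hx hx' => by
      obtain ⟨j, hj, b, hb, rfl⟩ := (hT _ x).1 hx
      rcases j with _ | j
      · exact absurd ((hT m _).2 ⟨0, by omega, b, hb, rfl⟩) hx'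
      · exact (hT _ _).2 ⟨j, by omega, b, hb, by rw [succ_nsmul]; abel⟩
    rw [← Set.ncard_sdiff_add_ncard_of_subset hsub (hTfin _), add_comm, ← himg]
    congr 1
    have hbij : π '' (T (m + 1) \ T m) = π '' boxSums v s q := by
      apply Set.Subset.antisymm
      · rintro _ ⟨x, ⟨hx, -⟩, rfl⟩
        obtain ⟨j, hj, b, hb, rfl⟩ := (hT _ x).1 hx
        exact ⟨b, hb, by simp [hπa]⟩
      · rintro _ ⟨b, hb, rfl⟩
        -- The ray from `b` along `v a` is infinite and `T m` is finite, so the ray must leave it.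
        obtain ⟨j, hj, hj'⟩ : ∃ j : ℕ, b + j • v a ∈ T m ∧ b + (j + 1) • v a ∉ T m := by
          by_contra! hcon
          have hall : ∀ j : ℕ, b + j • v a ∈ T m := fun j => by
            induction j with
            | zero => exact (hT _ _).2 ⟨0, by omega, b, hb, rfl⟩
            | succ j ihj => exact hcon j ihj
          exact Set.infinite_of_injective_forall_mem
            (fun i j hij => hinj (add_left_cancel hij)) hall (hTfin m)
        refine ⟨b + (j + 1) • v a, ⟨?_, hj'⟩, by simp [hπa]⟩
        have := hshift _ hj
        rwa [add_assoc, ← succ_nsmul] at this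
    rw [← hbij, Set.InjOn.ncard_image]
    -- Two new points on one line, shifted back by `v a`, both lie in `T m`; convexity then puts the
    -- earlier point `x` in `T m`.
    have main : ∀ x ∈ T (m + 1) \ T m, ∀ k : ℕ, x + (k + 1) • v a ∉ T (m + 1) \ T m := by
      intro x hx k hy
      refine hx.2 ?_
      have h1 := hunshift _ hx.1 hx.2
      have h2 := hunshift _ hy.1 hy.2
      have h3 : x + (k + 1) • v a - v a = x - v a + (k + 1) • v a := by abel
      rw [h3] at h2
      simpa using h.add_mem_boxSums h1 h2
    intro x hx y hy hxy
    obtain ⟨c, hc⟩ := Submodule.mem_span_singleton.1 ((Submodule.Quotient.eq _).1 hxy)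
    obtain ⟨k, rfl | rfl⟩ := c.eq_nat_or_neg
    · rcases k with _ | k
      · rw [← sub_eq_zero, ← hc]; simp
      · refine absurd hx (?_ : x ∉ _)
        have : x = y + (k + 1) • v a := by
          rw [← sub_add_cancel x y, ← hc, natCast_zsmul, add_comm]
        rw [this]
        exact main y hy k
    · rcases k with _ | k
      · rw [← sub_eq_zero, ← hc]; simp
      · refine absurd hy (?_ : y ∉ _)
        have : y = x + (k + 1) • v a := by
          rw [neg_smul, natCast_zsmul, neg_eq_iff_eq_neg, neg_sub] at hc
          rw [hc, add_sub_cancel]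
        rw [this]
        exact main x hx k
  have htotal : ∀ m, (T m).ncard = (boxSums v s q).ncard + m * (boxSums (π ∘ v) s q).ncard := by
    intro m
    induction m with
    | zero =>
      have : T 0 = boxSums v s q := by
        ext x
        simp [hT]
      simp [this]
    | succ m ih => rw [hstep, ih]; ring
  have := htotal (q a)
  simpa [T] using this

theorem boxSums_insert_of_eq_zero [DecidableEq ι] {a : ι} (ha : a ∉ s) (hv : v a = 0)
    (q : ι → ℕ) : boxSums v (insert a s) q = boxSums v s q := by
  ext x
  rw [mem_boxSums_insert ha]
  simp only [hv, smul_zero, add_zero]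
  exact ⟨fun ⟨_, _, _, hb, e⟩ => e ▸ hb, fun h => ⟨0, by omega, x, h, rfl⟩⟩

end

/-! ### Solving the recursion -/

open Classical in
/-- The number of points in a box sum of a box integral family. -/
theorem IsBoxIntegral.ncard_boxSums {ι : Type*} (s : Finset ι) (q : ι → ℕ) {M : Type*}
    [AddCommGroup M] (v : ι → M) (h : IsBoxIntegral v s) :
    (boxSums v s q).ncard =
      ∑ F ∈ s.powerset, if LinearIndepOn ℤ v (F : Set ι) then ∏ e ∈ F, q e else 0 := by
  induction s using Finset.induction_on generalizing M with
  | empty =>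
    have : boxSums v ∅ q = {0} := by ext x; simp [boxSums]
    simp [this]
  | insert a s ha ih =>
    rw [Finset.sum_powerset_insert ha, ← ih v (h.of_insert ha)]
    by_cases hv : v a = 0
    · rw [boxSums_insert_of_eq_zero ha hv, Finset.sum_eq_zero, add_zero]
      intro F _
      refine if_neg fun hF => hF.ne_zero (i := a) (by simp) hv
    · rw [h.ncard_boxSums_insert ha hv, ih _ (h.quotient ha), Finset.mul_sum]
      congr 1
      refine Finset.sum_congr rfl fun F hF => ?_
      have haF : a ∉ F := fun h' => ha (Finset.mem_powerset.1 hF h')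
      have hsing : LinearIndepOn ℤ v {a} := by
        rw [← Finset.coe_singleton, linearIndepOn_finset_iff]
        intro f hf i hi
        rw [Finset.mem_singleton] at hi
        subst hi
        rw [Finset.sum_singleton] at hf
        by_contra hfi
        refine hv (h.eq_zero_of_nsmul (Int.natAbs_pos.2 hfi) ?_)
        rw [← natCast_zsmul]
        rcases Int.natAbs_eq (f i) with e | e <;> rw [e] at hf <;> simpa using hf
      -- `F` is independent modulo `v a` exactly when `F` with `a` added is independent.
      have hiff := hsing.quotient_iff_union (t := (F : Set ι)) (by simpa using haF)
      rw [Set.image_singleton, Set.singleton_union] at hiff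
      rw [Finset.coe_insert, ← if_congr hiff rfl rfl, Finset.prod_insert haF, mul_ite, mul_zero]

/-! ### Return to the zonotope -/

/-- The columns of a totally unimodular matrix form a box integral family. -/
theorem Matrix.IsTotallyUnimodular.isBoxIntegral_col {m ι : Type*} [Fintype m] [Fintype ι]
    {A : Matrix m ι ℤ} (hA : A.IsTotallyUnimodular) : IsBoxIntegral A.col Finset.univ := by
  rintro q x k hk ⟨d, hd, hx⟩
  have hk' : (0 : ℝ) < k := by exact_mod_cast hk
  obtain ⟨d', hd', hx'⟩ := hA.exists_nat_solution q x (fun e => d e / k) (fun e => by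
    have h : (d e : ℝ) ≤ k * q e := by exact_mod_cast hd e (Finset.mem_univ e)
    exact ⟨by positivity, by rw [div_le_iff₀ hk']; linarith⟩) (fun i => by
    have h := congrFun hx i
    simp only [Pi.smul_apply, Finset.sum_apply, nsmul_eq_mul] at h
    have h' : (k : ℝ) * x i = ∑ e, (d e : ℝ) * A i e := by exact_mod_cast h
    simp only [div_mul_eq_mul_div]
    rw [← Finset.sum_div, ← h', mul_div_cancel_left₀ _ hk'.ne'])
  refine ⟨d', fun e _ => hd' e, funext fun i => ?_⟩
  simpa [Finset.sum_apply] using (hx' i).symm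

/-- The lattice points of the dilated zonotope of a totally unimodular matrix are the sums of its
columns with integral coefficients in the box. -/
theorem dilatedZonotope_inter_latticePoints {r n : ℕ} {A : Matrix (Fin r) (Fin n) ℤ}
    (hA : A.IsTotallyUnimodular) (q : Fin n → ℕ) :
    dilatedZonotope A q ∩ latticePoints r =
      (fun z : Fin r → ℤ => fun i => (z i : ℝ)) '' boxSums A.col Finset.univ q := by
  ext x
  constructor
  · rintro ⟨⟨c, hc, hx⟩, z, hz⟩
    obtain ⟨d, hd, hdz⟩ := hA.exists_nat_solution q z (fun e => c e * q e) (fun e =>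
      ⟨mul_nonneg (hc e).1 (Nat.cast_nonneg _),
        mul_le_of_le_one_left (Nat.cast_nonneg _) (hc e).2⟩) (fun i => by
      rw [← hz i, hx]
      simp [Finset.sum_apply, realColumn])
    refine ⟨z, ⟨d, fun e _ => hd e, funext fun i => ?_⟩, funext fun i => (hz i).symm⟩
    simpa [Finset.sum_apply] using (hdz i).symm
  · rintro ⟨z, ⟨d, hd, rfl⟩, rfl⟩
    refine ⟨⟨fun e => d e / q e, fun e => ⟨by positivity, ?_⟩, funext fun i => ?_⟩,
      _, fun i => rfl⟩
    · exact div_le_one_of_le₀ (by exact_mod_cast hd e (Finset.mem_univ e)) (Nat.cast_nonneg _)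
    · simp only [Finset.sum_apply, Pi.smul_apply, realColumn, smul_eq_mul]
      push_cast
      refine Finset.sum_congr rfl fun e _ => ?_
      -- If `q e = 0`, the quotient `d e / q e` is 0 by convention, and `d e = 0` too.
      rcases Nat.eq_zero_or_pos (q e) with h | h
      · have := hd e (Finset.mem_univ e)
        simp [show d e = 0 by omega]
      · rw [div_mul_cancel₀ _ (by positivity)]
        simp

theorem linearIndependent_realColumn_iff {r n : ℕ} (A : Matrix (Fin r) (Fin n) ℤ)
    (F : Finset (Fin n)) :
    LinearIndependent ℝ (fun e : F => realColumn A e) ↔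
      LinearIndepOn ℤ A.col (F : Set (Fin n)) :=
  linearIndependent_algebraMap_comp_iff (R := ℤ) (S := ℝ) (v := fun e : F => A.col e)

theorem proposition3p22 {r n : ℕ} (A : Matrix (Fin r) (Fin n) ℤ)
    (hA : A.IsTotallyUnimodular) (q : Fin n → ℕ) (hq : ∀ e, 0 < q e) :
    (dilatedZonotope A q ∩ latticePoints r).Finite ∧
      generalizedEhrhart A q = ∑ F ∈ independentColumnSets A, ∏ e ∈ F, q e := by
  classical
  have hinj : Function.Injective (fun z : Fin r → ℤ => fun i => (z i : ℝ)) := fun z z' h =>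
    funext fun i => Int.cast_injective (congrFun h i)
  rw [generalizedEhrhart, dilatedZonotope_inter_latticePoints hA]
  refine ⟨(boxSums_finite _ _ _).image _, ?_⟩
  rw [Set.ncard_image_of_injective _ hinj, hA.isBoxIntegral_col.ncard_boxSums,
    independentColumnSets, Finset.sum_filter, Finset.powerset_univ]
  refine Finset.sum_congr rfl fun F _ => ?_
  simp only [linearIndependent_realColumn_iff]
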